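/- **Theorem (Rotation uniformizes coordinate variances).** Let $D\ge 1$, let $Q$ be a Haar-distributed random matrix in the orthogonal group $O(D)$, and let $q_i^\top$ denote its $i$-th row. Let $\operatorname{sign}(t)\in\{-1,0,1\}$ be the sign of $t$, applied to vectors coordinatewise. (a) $\operatorname{sign}(Qx)$ is a random-hyperplane locality-sensitive hash: for every $i\in\{1,\dots,D\}$, the coordinate hash $h_i(x)=\operatorname{sign}(Qx)_i$ is of the form $h_i(x)=\operatorname{sign}\langle r,x\rangle$ with a random vector $r$ (the normal of the hyperplane) uniformly distributed on the unit sphere $\mathbb S^{D-1}$, and for all nonzero $x,y\in\mathbb R^D$, with $\cos(x,y)=\langle x,y\rangle/(\|x\|\,\|y\|)$, $$P[h_i(x)=h_i(y)]=1-\frac{\arccos(\cos(x,y))}{\pi}.$$ (b) For every $c>0$ there is a constant $C>0$, depending only on $c$, such that for every $D\ge1$, every Haar-random $Q\in O(D)$ and every covariance (i.e. symmetric positive semidefinite) matrix $\Sigma\in\mathbb R^{D\times D}$, with probability at least $1-D^{-c}$, $$\max_{1\le i\le D}\left|q_i^\top\Sigma q_i-\frac{\operatorname{tr}(\Sigma)}{D}\right|\le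 C\,\|\Sigma\|_{\mathrm{op}}\sqrt{\frac{\log D}{D}}.$$ -/

import Mathlib

open MeasureTheory ProbabilityTheory
open scoped Matrix RealInnerProductSpace

noncomputable section

/-- The uniform probability measure on the unit sphere of `ℝ^D` (normalized surface measure),
regarded as a measure on `ℝ^D`. -/
def uniformSphere (D : ℕ) : Measure (EuclideanSpace ℝ (Fin D)) :=
  (((volume : Measure (EuclideanSpace ℝ (Fin D))).toSphere Set.univ)⁻¹ •
    (volume : Measure (EuclideanSpace ℝ (Fin D))).toSphere).map Subtype.val

/-- A random hash function `h` on `ℝ^D` is a random-hyperplane hash if `h(x)` records on which side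
of the hyperplane `r^⊥` the point `x` lies, with `r` uniformly distributed on the unit sphere. -/
def IsRandomHyperplaneHash {Ω : Type*} [MeasurableSpace Ω] {D : ℕ}
    (h : Ω → EuclideanSpace ℝ (Fin D) → SignType) (P : Measure Ω) : Prop :=
  ∃ r : Ω → EuclideanSpace ℝ (Fin D), HasLaw r (uniformSphere D) P ∧
    ∀ ω x, h ω x = SignType.sign ⟪r ω, x⟫

/-- The coordinatewise sign vector `sign(Ax)`. -/
def signHash {D : ℕ} (A : Matrix (Fin D) (Fin D) ℝ) (x : EuclideanSpace ℝ (Fin D)) :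
    Fin D → SignType :=
  fun i => SignType.sign ((A *ᵥ x.ofLp) i)

/-- The cosine similarity `⟨x, y⟩ / (‖x‖ ‖y‖)`. -/
def cosSim {D : ℕ} (x y : EuclideanSpace ℝ (Fin D)) : ℝ :=
  ⟪x, y⟫ / (‖x‖ * ‖y‖)

/-- The Borel σ-algebra on `O(D)` (whose topology is the one inherited from matrices). -/
instance orthogonalGroupMeasurableSpace (D : ℕ) :
    MeasurableSpace (Matrix.orthogonalGroup (Fin D) ℝ) :=
  borel _

instance orthogonalGroupBorelSpace (D : ℕ) : BorelSpace (Matrix.orthogonalGroup (Fin D) ℝ) :=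
  ⟨rfl⟩

/-- `Q` is a Haar-random orthogonal matrix: its law is a Haar measure on the compact group `O(D)`.
(The law is a probability measure whenever `P` is one.) -/
def IsHaarRandom {Ω : Type*} [MeasurableSpace Ω] {D : ℕ}
    (Q : Ω → Matrix.orthogonalGroup (Fin D) ℝ) (P : Measure Ω) : Prop :=
  AEMeasurable Q P ∧ (P.map Q).IsHaarMeasure

/-- The operator norm of a matrix acting on Euclidean space. -/
def opNorm {D : ℕ} (S : Matrix (Fin D) (Fin D) ℝ) : ℝ :=
  ‖Matrix.toEuclideanCLM (𝕜 := ℝ) S‖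

/-- The `i`-th coordinate variance after rotation, `q_i^⊤ S q_i`, where `q_i^⊤` is the `i`-th row
of `A`. -/
def rotatedVariance {D : ℕ} (A S : Matrix (Fin D) (Fin D) ℝ) (i : Fin D) : ℝ :=
  A.row i ⬝ᵥ (S *ᵥ A.row i)

end

/-!
Each row of a Haar-random orthogonal matrix is `Q⁻¹ eᵢ`. Its law agrees with every rotation
invariant probability measure on the sphere, because averaging such a measure over `O(D)` gives the
law of `Q⁻¹ x` for any unit vector `x`. In particular the rows are distributed like `g / ‖g‖` with
`g` standard Gaussian, and for events invariant under positive dilations the normalization can be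
dropped.

For unit vectors `x` and `y` the vectors `x + y` and `x - y` are orthogonal, so `⟪x + y, g⟫` and
`⟪x - y, g⟫` are independent Gaussians with standard deviations `2 cos (θ / 2)` and
`2 sin (θ / 2)`, where `θ` is the angle between `x` and `y`. Since
`4 ⟪x, g⟫ ⟪y, g⟫ = ⟪x + y, g⟫ ^ 2 - ⟪x - y, g⟫ ^ 2`, the signs differ on a double cone of the plane,
whose Gaussian measure `θ / π` is read off in polar coordinates.

For the variances, the deviation of `⟪T q, q⟫` from `trace T / D` becomes the event
`ε ‖T‖ ‖g‖ ^ 2 < |⟪T g, g⟫ - trace T / D * ‖g‖ ^ 2|`. In principal axes of the symmetric part of `T`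
it concerns a trace-free weighted sum of independent squared Gaussians, for which Chernoff's method
gives a tail of order `exp (-D ε ^ 2 / 128)`. With `ε` of order `√(log D / D)` this beats the union
bound over the `D` rows.
-/

section GaussianQuadraticForm

lemma inv_sqrt_one_sub_le_exp {u : ℝ} (hu : |u| ≤ 1 / 2) :
    (√(1 - u))⁻¹ ≤ Real.exp (u / 2 + u ^ 2) := by
  have hpos : 0 < 1 - u := by linarith [le_abs_self u]
  have hlog : -Real.log (1 - u) ≤ u + 2 * u ^ 2 := by
    have htaylor := Real.abs_log_sub_add_sum_range_le (x := u) (by linarith) 1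
    have hrem : |u| ^ (1 + 1) / (1 - |u|) ≤ 2 * u ^ 2 := by
      rw [div_le_iff₀ (by linarith), one_add_one_eq_two, sq_abs]
      nlinarith [sq_nonneg u]
    simp only [Finset.sum_range_one, zero_add, pow_one, Nat.cast_zero, div_one] at htaylor
    linarith [neg_abs_le (u + Real.log (1 - u))]
  rw [← Real.exp_log (Real.sqrt_pos.2 hpos), Real.log_sqrt hpos.le, ← Real.exp_neg]
  gcongr
  linarith

lemma integral_exp_mul_sq_gaussianReal {v : NNReal} {a : ℝ} (ha : 2 * a * v < 1) :
    ∫ x, Real.exp (a * x ^ 2) ∂(gaussianReal 0 v) = (√(1 - 2 * a * v))⁻¹ := by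
  rcases eq_or_ne v 0 with rfl | hv
  · simp
  have : (0 : ℝ) < v := by positivity
  have hdensity (x : ℝ) : gaussianPDFReal 0 v x • Real.exp (a * x ^ 2) =
      (√(2 * Real.pi * v))⁻¹ * Real.exp (-((1 - 2 * a * v) / (2 * v)) * x ^ 2) := by
    rw [gaussianPDFReal, smul_eq_mul, mul_assoc, ← Real.exp_add]
    congr 2
    field_simp
    ring
  have : 0 < 1 - 2 * a * v := by linarith
  simp_rw [integral_gaussianReal_eq_integral_smul hv, hdensity, integral_const_mul,
    integral_gaussian, ← Real.sqrt_inv]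
  rw [← Real.sqrt_mul (by positivity)]
  congr 1
  field_simp

lemma integrable_exp_mul_sq_gaussianReal {v : NNReal} {a : ℝ} (ha : 2 * a * v < 1) :
    Integrable (fun x => Real.exp (a * x ^ 2)) (gaussianReal 0 v) := by
  refine not_imp_comm.1 integral_undef ?_
  rw [integral_exp_mul_sq_gaussianReal ha]
  have : 0 < 1 - 2 * a * v := by linarith
  positivity

lemma measureReal_pi_gaussianReal_sum_mul_sq_pos_le {ι : Type*} [Fintype ι] {v : ι → ℝ}
    (hv : ∀ i, |v i| ≤ 1 / 4) :
    (Measure.pi fun _ : ι => gaussianReal 0 1).real {x | 0 < ∑ i, v i * x i ^ 2} ≤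
      Real.exp (∑ i, (v i + 4 * v i ^ 2)) := by
  have hlt (i : ι) : 2 * v i * (1 : NNReal) < 1 := by
    rw [NNReal.coe_one]
    linarith [(abs_le.1 (hv i)).2]
  have hmarkov := mul_meas_ge_le_integral_of_nonneg
    (ae_of_all _ fun x => Finset.prod_nonneg fun i _ => (Real.exp_pos (v i * x i ^ 2)).le)
    (Integrable.fintype_prod (f := fun i y => Real.exp (v i * y ^ 2)) fun i =>
      integrable_exp_mul_sq_gaussianReal (hlt i)) 1
  have hsub : {x : ι → ℝ | 0 < ∑ i, v i * x i ^ 2} ⊆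
      {x | 1 ≤ ∏ i, Real.exp (v i * x i ^ 2)} := fun x hx => by
    simpa only [Set.mem_ofPred_eq, ← Real.exp_sum, Real.one_le_exp_iff] using le_of_lt hx
  calc _ ≤ ∫ x : ι → ℝ, ∏ i, Real.exp (v i * x i ^ 2) ∂(Measure.pi fun _ => gaussianReal 0 1) :=
        (measureReal_mono hsub).trans (by rwa [one_mul] at hmarkov)
    _ = ∏ i, (√(1 - 2 * v i))⁻¹ := by
        rw [integral_fintype_prod_eq_prod (f := fun i y => Real.exp (v i * y ^ 2))]
        exact Finset.prod_congr rfl fun i _ => by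
          rw [integral_exp_mul_sq_gaussianReal (hlt i), NNReal.coe_one, mul_one]
    _ ≤ ∏ i, Real.exp (v i + 4 * v i ^ 2) := by
        refine Finset.prod_le_prod (fun i _ => by positivity) fun i _ => ?_
        have hv2 : |2 * v i| ≤ 1 / 2 := by
          rw [abs_mul, abs_two]
          linarith [hv i]
        exact (inv_sqrt_one_sub_le_exp hv2).trans_eq (by ring_nf)
    _ = Real.exp (∑ i, (v i + 4 * v i ^ 2)) := (Real.exp_sum _ _).symm

lemma measureReal_pi_gaussianReal_lt_sum_mul_sq_le {ι : Type*} [Fintype ι] {w : ι → ℝ}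
    (hsum : ∑ i, w i = 0) (hw : ∀ i, |w i| ≤ 1) {ε : ℝ} (hε : 0 ≤ ε) :
    (Measure.pi fun _ : ι => gaussianReal 0 1).real
      {x | ε * ∑ i, x i ^ 2 < ∑ i, w i * x i ^ 2} ≤
      Real.exp (-(Fintype.card ι * ε ^ 2 / 32)) := by
  rcases hε.eq_or_lt with rfl | hpos
  · exact measureReal_le_one.trans (by simp)
  rcases lt_or_ge 1 ε with hlarge | hsmall
  · have hempty : {x : ι → ℝ | ε * ∑ i, x i ^ 2 < ∑ i, w i * x i ^ 2} = ∅ := by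
      refine Set.eq_empty_of_forall_notMem fun x => ?_
      rw [Set.mem_ofPred_eq, not_lt, Finset.mul_sum]
      exact Finset.sum_le_sum fun i _ => by
        gcongr
        linarith [(abs_le.1 (hw i)).2]
    rw [hempty, measureReal_empty]
    positivity
  -- `λ = ε / 16` minimizes the Chernoff exponent `8 * λ ^ 2 - λ * ε` per coordinate.
  set v : ι → ℝ := fun i => ε / 16 * (w i - ε) with hv_def
  have hv (i : ι) : |v i| ≤ 1 / 4 := by
    rw [hv_def, abs_mul, abs_of_nonneg (by positivity)]
    have : |w i - ε| ≤ 2 := (abs_sub _ _).trans (by linarith [hw i, abs_of_nonneg hε])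
    nlinarith [abs_nonneg (w i - ε)]
  have hevent : {x : ι → ℝ | ε * ∑ i, x i ^ 2 < ∑ i, w i * x i ^ 2} ⊆
      {x | 0 < ∑ i, v i * x i ^ 2} := fun x hx => by
    have : ∑ i, v i * x i ^ 2 = ε / 16 * (∑ i, w i * x i ^ 2 - ε * ∑ i, x i ^ 2) := by
      simp only [hv_def, Finset.mul_sum, ← Finset.sum_sub_distrib]
      exact Finset.sum_congr rfl fun i _ => by ring
    rw [Set.mem_ofPred_eq, this]
    exact mul_pos (by positivity) (sub_pos.2 hx)
  calc _ ≤ Real.exp (∑ i, (v i + 4 * v i ^ 2)) :=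
        (measureReal_mono hevent).trans (measureReal_pi_gaussianReal_sum_mul_sq_pos_le hv)
    _ ≤ Real.exp (∑ i, ((ε / 16 - ε ^ 3 / 32) * w i - ε ^ 2 / 32)) := by
        gcongr with i
        have : w i ^ 2 ≤ 1 := (sq_le_one_iff_abs_le_one _).2 (hw i)
        have : ε ^ 2 ≤ 1 := pow_le_one₀ hε hsmall
        simp only [hv_def]
        nlinarith [mul_nonneg (sq_nonneg ε) (sq_nonneg (w i))]
    _ = Real.exp (-(Fintype.card ι * ε ^ 2 / 32)) := by
        rw [Finset.sum_sub_distrib, ← Finset.mul_sum, hsum, Finset.sum_const, Finset.card_univ,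
          nsmul_eq_mul]
        ring_nf

section

variable {E : Type*} [NormedAddCommGroup E] [InnerProductSpace ℝ E]

lemma abs_inner_map_self_le (T : E →L[ℝ] E) (x : E) : |⟪T x, x⟫| ≤ ‖T‖ * ‖x‖ ^ 2 :=
  calc |⟪T x, x⟫| ≤ ‖T x‖ * ‖x‖ := abs_real_inner_le_norm _ _
    _ ≤ ‖T‖ * ‖x‖ * ‖x‖ := by gcongr; exact T.le_opNorm x
    _ = ‖T‖ * ‖x‖ ^ 2 := by ring

variable [FiniteDimensional ℝ E]

lemma abs_trace_le_finrank_mul_norm (T : E →L[ℝ] E) :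
    |LinearMap.trace ℝ E T| ≤ Module.finrank ℝ E * ‖T‖ := by
  set b := stdOrthonormalBasis ℝ E
  rw [LinearMap.trace_eq_sum_inner _ b]
  refine (Finset.abs_sum_le_sum_abs _ _).trans ?_
  refine (Finset.sum_le_card_nsmul _ _ ‖T‖ fun i _ => ?_).trans_eq (by simp)
  rw [real_inner_comm]
  simpa using abs_inner_map_self_le T (b i)

lemma exists_orthonormalBasis_inner_map_self_eq_sum (T : E →ₗ[ℝ] E) :
    ∃ b : OrthonormalBasis (Fin (Module.finrank ℝ E)) ℝ E,
      ∀ x, ⟪T x, x⟫ = ∑ i, ⟪T (b i), b i⟫ * ⟪b i, x⟫ ^ 2 := by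
  let A : E →ₗ[ℝ] E := (2 : ℝ)⁻¹ • (T + T.adjoint)
  have hA (x : E) : ⟪A x, x⟫ = ⟪T x, x⟫ := by
    simp only [A, LinearMap.smul_apply, LinearMap.add_apply, real_inner_smul_left, inner_add_left,
      LinearMap.adjoint_inner_left, real_inner_comm (T x)]
    ring
  have hsymm : A.IsSymmetric := fun x y => by
    simp only [A, LinearMap.smul_apply, LinearMap.add_apply, real_inner_smul_left,
      real_inner_smul_right, inner_add_left, inner_add_right, LinearMap.adjoint_inner_left,
      LinearMap.adjoint_inner_right, add_comm]
  refine ⟨hsymm.eigenvectorBasis rfl, fun x => ?_⟩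
  set b := hsymm.eigenvectorBasis rfl
  simp_rw [← hA, ← b.sum_inner_mul_inner (A x) x]
  refine Finset.sum_congr rfl fun i _ => ?_
  have heigen : A (b i) = hsymm.eigenvalues rfl i • b i := hsymm.apply_eigenvectorBasis rfl i
  rw [hsymm x, heigen, real_inner_smul_left, real_inner_smul_right, real_inner_self_eq_norm_sq,
    b.norm_eq_one, real_inner_comm x]
  ring

variable [MeasurableSpace E] [BorelSpace E]

lemma map_inner_orthonormalBasis_stdGaussian {ι : Type*} [Fintype ι] (b : OrthonormalBasis ι ℝ E) :
    (stdGaussian E).map (fun g i => ⟪b i, g⟫) = Measure.pi fun _ => gaussianReal 0 1 := by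
  classical
  rw [stdGaussian_eq_map_pi_orthonormalBasis b, Measure.map_map (by fun_prop) (by fun_prop)]
  convert Measure.map_id
  ext x i
  simp [inner_sum, inner_smul_right, b.inner_eq_ite]

lemma measureReal_stdGaussian_lt_inner_map_self_le {A : E →L[ℝ] E}
    (htr : LinearMap.trace ℝ E A = 0) (hA : ‖A‖ ≤ 1) {ε : ℝ} (hε : 0 ≤ ε) :
    (stdGaussian E).real {g | ε * ‖g‖ ^ 2 < ⟪A g, g⟫} ≤
      Real.exp (-(Module.finrank ℝ E * ε ^ 2 / 32)) := by
  obtain ⟨b, hb⟩ := exists_orthonormalBasis_inner_map_self_eq_sum (A : E →ₗ[ℝ] E)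
  simp only [ContinuousLinearMap.coe_coe] at hb
  have hsum : ∑ i, ⟪A (b i), b i⟫ = 0 := by
    simpa only [LinearMap.trace_eq_sum_inner _ b, ContinuousLinearMap.coe_coe,
      real_inner_comm] using htr
  have hle (i) : |⟪A (b i), b i⟫| ≤ 1 :=
    (abs_inner_map_self_le A (b i)).trans (by simpa using hA)
  have htail := measureReal_pi_gaussianReal_lt_sum_mul_sq_le hsum hle hε
  rw [← map_inner_orthonormalBasis_stdGaussian b, map_measureReal_apply (by fun_prop)
    (measurableSet_lt (by fun_prop) (by fun_prop))] at htail
  simpa only [Set.preimage_ofPred_eq, b.sum_sq_inner_right, ← hb, Fintype.card_fin] using htail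

lemma measureReal_stdGaussian_lt_abs_inner_map_self_le {A : E →L[ℝ] E}
    (htr : LinearMap.trace ℝ E A = 0) (hA : ‖A‖ ≤ 1) {ε : ℝ} (hε : 0 ≤ ε) :
    (stdGaussian E).real {g | ε * ‖g‖ ^ 2 < |⟪A g, g⟫|} ≤
      2 * Real.exp (-(Module.finrank ℝ E * ε ^ 2 / 32)) := by
  have hunion : {g | ε * ‖g‖ ^ 2 < |⟪A g, g⟫|} =
      {g | ε * ‖g‖ ^ 2 < ⟪A g, g⟫} ∪ {g | ε * ‖g‖ ^ 2 < ⟪(-A) g, g⟫} := by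
    ext g
    simp only [Set.mem_union, Set.mem_ofPred_eq, lt_abs, neg_apply, inner_neg_left]
  rw [hunion, two_mul]
  exact (measureReal_union_le _ _).trans <| add_le_add
    (measureReal_stdGaussian_lt_inner_map_self_le htr hA hε)
    (measureReal_stdGaussian_lt_inner_map_self_le (by simpa using htr) (by rwa [norm_neg]) hε)

lemma measureReal_stdGaussian_lt_abs_inner_map_self_sub_le (T : E →L[ℝ] E) {ε : ℝ} (hε : 0 ≤ ε) :
    (stdGaussian E).real {g | ε * ‖T‖ * ‖g‖ ^ 2 <
      |⟪T g, g⟫ - LinearMap.trace ℝ E T / Module.finrank ℝ E * ‖g‖ ^ 2|} ≤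
      2 * Real.exp (-(Module.finrank ℝ E * ε ^ 2 / 128)) := by
  rcases eq_or_ne T 0 with rfl | hT
  · simp [Real.exp_nonneg]
  have : Nontrivial E := not_subsingleton_iff_nontrivial.1 fun _ => hT (Subsingleton.elim _ _)
  have hn : (0 : ℝ) < Module.finrank ℝ E := by exact_mod_cast Module.finrank_pos
  have hpos : 0 < 2 * ‖T‖ := by positivity
  set m := LinearMap.trace ℝ E T / Module.finrank ℝ E with hm
  have hmean : |m| ≤ ‖T‖ := by
    rw [hm, abs_div, abs_of_pos hn, div_le_iff₀' hn]
    exact abs_trace_le_finrank_mul_norm T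
  let A : E →L[ℝ] E := (2 * ‖T‖)⁻¹ • (T - m • ContinuousLinearMap.id ℝ E)
  have htr : LinearMap.trace ℝ E A = 0 := by
    simp [A, hm, hn.ne']
  have hA : ‖A‖ ≤ 1 := by
    rw [norm_smul, norm_inv, Real.norm_of_nonneg hpos.le, inv_mul_le_one₀ hpos, two_mul]
    refine (norm_sub_le _ _).trans (add_le_add_right ?_ _)
    rw [norm_smul, Real.norm_eq_abs]
    nlinarith [ContinuousLinearMap.norm_id_le (𝕜 := ℝ) (E := E), abs_nonneg m]
  have hquad (g : E) : ⟪A g, g⟫ = (2 * ‖T‖)⁻¹ * (⟪T g, g⟫ - m * ‖g‖ ^ 2) := by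
    simp [A, inner_sub_left, real_inner_smul_left]
  have htail := measureReal_stdGaussian_lt_abs_inner_map_self_le htr hA (by positivity : 0 ≤ ε / 2)
  have hevent : {g | ε * ‖T‖ * ‖g‖ ^ 2 < |⟪T g, g⟫ - m * ‖g‖ ^ 2|} =
      {g | ε / 2 * ‖g‖ ^ 2 < |⟪A g, g⟫|} := by
    ext g
    rw [Set.mem_ofPred_eq, Set.mem_ofPred_eq, hquad, abs_mul, abs_of_pos (inv_pos.2 hpos),
      ← div_eq_inv_mul, lt_div_iff₀ hpos]
    ring_nf
  rw [hevent]
  exact htail.trans_eq (by ring_nf)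

end

end GaussianQuadraticForm

section Orbit

open MulAction

lemma map_inv_smul_eq_of_ae_mem_orbit {G X : Type*} [Group G] [MeasurableSpace G]
    [MeasurableMul G] [MeasurableInv G] [MeasurableSpace X] [MulAction G X] [MeasurableSMul₂ G X]
    (μ : Measure G) [IsProbabilityMeasure μ] [μ.IsMulLeftInvariant]
    {ρ : Measure X} [IsProbabilityMeasure ρ] [SMulInvariantMeasure G X ρ]
    {x₀ : X} (hρ : ∀ᵐ x ∂ρ, x ∈ orbit G x₀) :
    μ.map (fun g => g⁻¹ • x₀) = ρ := by
  refine Measure.ext_of_lintegral _ fun F hF => ?_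
  have hjoint : Measurable fun p : G × X => F (p.1⁻¹ • p.2) := by fun_prop
  calc ∫⁻ x, F x ∂(μ.map fun g => g⁻¹ • x₀) = ∫⁻ _, ∫⁻ g, F (g⁻¹ • x₀) ∂μ ∂ρ := by
        rw [lintegral_map hF (by fun_prop)]
        simp
    _ = ∫⁻ x, ∫⁻ g, F (g⁻¹ • x) ∂μ ∂ρ := by
        refine lintegral_congr_ae ?_
        filter_upwards [hρ] with x hx
        obtain ⟨h, rfl⟩ := hx
        rw [← lintegral_mul_left_eq_self _ h⁻¹]
        simp only [mul_inv_rev, inv_inv, mul_smul]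
    _ = ∫⁻ g, ∫⁻ x, F (g⁻¹ • x) ∂ρ ∂μ :=
        (lintegral_lintegral_swap (f := fun g x => F (g⁻¹ • x)) hjoint.aemeasurable).symm
    _ = ∫⁻ x, F x ∂ρ := by
        simp [fun g : G => (measurePreserving_smul g⁻¹ ρ).lintegral_comp hF]

end Orbit

section UniformOnSphere

/-- A probability measure on a normed space is uniform on the unit sphere if it is concentrated on
the unit sphere and invariant under linear isometries. On a Euclidean space this property determines
the measure, so it is how laws on the sphere are recognized here. -/
structure IsUniformOnSphere {V : Type*} [NormedAddCommGroup V] [NormedSpace ℝ V]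
    [MeasurableSpace V] (ρ : Measure V) : Prop extends IsProbabilityMeasure ρ where
  ae_norm_eq_one : ∀ᵐ x ∂ρ, ‖x‖ = 1
  map_eq : ∀ f : V ≃ₗᵢ[ℝ] V, ρ.map f = ρ

open scoped Pointwise in
lemma map_uniformSphere {D : ℕ} (f : EuclideanSpace ℝ (Fin D) ≃ₗᵢ[ℝ] EuclideanSpace ℝ (Fin D)) :
    (uniformSphere D).map f = uniformSphere D := by
  have hf := f.continuous.measurable
  ext s hs
  rw [Measure.map_apply hf hs, uniformSphere, Measure.map_apply (by fun_prop) (hf hs),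
    Measure.map_apply (by fun_prop) hs, Measure.smul_apply, Measure.smul_apply,
    Measure.toSphere_apply' _ (measurable_subtype_coe (hf hs)),
    Measure.toSphere_apply' _ (measurable_subtype_coe hs)]
  simp only [Subtype.image_preimage_coe]
  have hcone : f ⁻¹' (Set.Ioo (0 : ℝ) 1 • (Metric.sphere 0 1 ∩ s)) =
      Set.Ioo (0 : ℝ) 1 • (Metric.sphere 0 1 ∩ f ⁻¹' s) := by
    have himage (t) : f ⁻¹' t = f.symm '' t := (f.symm.image_eq_preimage_symm t).symm
    have hsphere : Metric.sphere 0 1 ∩ f ⁻¹' s = f.symm '' (Metric.sphere 0 1 ∩ s) := by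
      rw [← himage, Set.preimage_inter, f.preimage_sphere, map_zero]
    rw [himage, hsphere]
    exact Set.image_image2_distrib_right fun r x => map_smul f.symm r x
  rw [← hcone, f.measurePreserving.measure_preimage_emb f.toHomeomorph.measurableEmbedding]

lemma isUniformOnSphere_uniformSphere {D : ℕ} (hD : 0 < D) :
    IsUniformOnSphere (uniformSphere D) where
  toIsProbabilityMeasure := by
    have : Nonempty (Fin D) := Fin.pos_iff_nonempty.1 hD
    have : NeZero (volume : Measure (EuclideanSpace ℝ (Fin D))).toSphere :=
      ⟨Measure.toSphere_ne_zero _⟩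
    exact Measure.isProbabilityMeasure_map (by fun_prop)
  ae_norm_eq_one := by
    rw [uniformSphere, ae_map_iff (by fun_prop) (measurableSet_eq_fun (by fun_prop) (by fun_prop))]
    exact ae_of_all _ norm_eq_of_mem_sphere
  map_eq := map_uniformSphere

lemma measurable_normalize {V : Type*} [NormedAddCommGroup V] [NormedSpace ℝ V]
    [MeasurableSpace V] [BorelSpace V] [SecondCountableTopology V] :
    Measurable (NormedSpace.normalize : V → V) := by
  unfold NormedSpace.normalize
  fun_prop

variable {E : Type*} [NormedAddCommGroup E] [InnerProductSpace ℝ E] [FiniteDimensional ℝ E]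
  [MeasurableSpace E] [BorelSpace E]

lemma map_inner_stdGaussian (a : E) :
    (stdGaussian E).map (fun g => ⟪a, g⟫) = gaussianReal 0 (‖a‖₊ ^ 2) := by
  refine (IsGaussian.map_eq_gaussianReal (innerSL ℝ a)).trans ?_
  rw [variance_dual_stdGaussian, integral_strongDual_stdGaussian, innerSL_apply_norm]
  congr 1
  ext
  simp

lemma ae_inner_ne_zero_stdGaussian {a : E} (ha : a ≠ 0) :
    ∀ᵐ g ∂(stdGaussian E), ⟪a, g⟫ ≠ 0 := by
  have := nullSingletonClass_gaussianReal (μ := 0) (v := ‖a‖₊ ^ 2) (by simpa using ha)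
  have hne : ∀ᵐ y ∂((stdGaussian E).map fun g => ⟪a, g⟫), y ≠ 0 :=
    map_inner_stdGaussian a ▸ Measure.ae_ne _ _
  exact ae_of_ae_map (f := fun g => ⟪a, g⟫) (by fun_prop) hne

lemma isUniformOnSphere_map_normalize_stdGaussian [Nontrivial E] :
    IsUniformOnSphere ((stdGaussian E).map NormedSpace.normalize) := by
  refine ⟨Measure.isProbabilityMeasure_map measurable_normalize.aemeasurable, ?_, fun f => ?_⟩
  · rw [ae_map_iff measurable_normalize.aemeasurable
      (measurableSet_eq_fun (by fun_prop) (by fun_prop))]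
    obtain ⟨x, hx⟩ := exists_ne (0 : E)
    filter_upwards [ae_inner_ne_zero_stdGaussian hx] with g hg
    rw [NormedSpace.norm_normalize_eq_one_iff]
    rintro rfl
    exact hg (inner_zero_right x)
  · have hf := f.continuous.measurable
    have hcomm : f ∘ NormedSpace.normalize = NormedSpace.normalize ∘ f := by
      ext g
      simp [NormedSpace.normalize]
    rw [Measure.map_map hf measurable_normalize, hcomm,
      ← Measure.map_map measurable_normalize hf, stdGaussian_map]

/-- A set is conical if it is invariant under positive dilations; the probability that a random
vector falls in a conical set depends on the direction of the vector only. -/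
def IsConical {V : Type*} [SMul ℝ V] (s : Set V) : Prop :=
  ∀ r : ℝ, 0 < r → ∀ x, r • x ∈ s ↔ x ∈ s

lemma IsConical.normalize_mem_iff {V : Type*} [NormedAddCommGroup V] [NormedSpace ℝ V] {s : Set V}
    (hs : IsConical s) (x : V) : NormedSpace.normalize x ∈ s ↔ x ∈ s := by
  rcases eq_or_ne x 0 with rfl | hx
  · rw [NormedSpace.normalize_zero_eq_zero]
  · exact hs _ (inv_pos.2 (norm_pos_iff.2 hx)) x

end UniformOnSphere

section OrthogonalGroup

variable {ι : Type*} [Fintype ι] [DecidableEq ι]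

/-- Orthogonal matrices as the linear isometries of Euclidean space. -/
noncomputable def orthogonalGroupEquivLinearIsometryEquiv :
    Matrix.orthogonalGroup ι ℝ ≃* (EuclideanSpace ℝ ι ≃ₗᵢ[ℝ] EuclideanSpace ℝ ι) :=
  (Unitary.mapEquiv <|
    StarMulEquiv.ofClass <| Matrix.toEuclideanCLM (𝕜 := ℝ) (n := ι)).toMulEquiv.trans
      Unitary.linearIsometryEquiv

lemma orthogonalGroupEquivLinearIsometryEquiv_apply (U : Matrix.orthogonalGroup ι ℝ)
    (x : EuclideanSpace ℝ ι) : orthogonalGroupEquivLinearIsometryEquiv U x = U • x := rfl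

lemma norm_orthogonalGroup_smul (U : Matrix.orthogonalGroup ι ℝ) (x : EuclideanSpace ℝ ι) :
    ‖U • x‖ = ‖x‖ :=
  (orthogonalGroupEquivLinearIsometryEquiv U).norm_map x

lemma mem_orbit_orthogonalGroup_iff {x y : EuclideanSpace ℝ ι} :
    y ∈ MulAction.orbit (Matrix.orthogonalGroup ι ℝ) x ↔ ‖x‖ = ‖y‖ := by
  constructor
  · rintro ⟨U, rfl⟩
    exact (norm_orthogonalGroup_smul U x).symm
  · intro h
    obtain ⟨U, hU⟩ := orthogonalGroupEquivLinearIsometryEquiv.surjective (ℝ ∙ (x - y))ᗮ.reflection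
    refine ⟨U, ?_⟩
    simp only [← orthogonalGroupEquivLinearIsometryEquiv_apply, hU, Submodule.reflection_sub h]

instance secondCountableTopology_orthogonalGroup :
    SecondCountableTopology (Matrix.orthogonalGroup ι ℝ) :=
  have : SecondCountableTopology (Matrix ι ι ℝ) :=
    inferInstanceAs (SecondCountableTopology (ι → ι → ℝ))
  TopologicalSpace.Subtype.secondCountableTopology _

instance continuousSMul_orthogonalGroup :
    ContinuousSMul (Matrix.orthogonalGroup ι ℝ) (EuclideanSpace ℝ ι) where
  continuous_smul := (PiLp.continuous_toLp 2 _).comp <|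
    (continuous_subtype_val.comp continuous_fst).matrix_mulVec
      ((PiLp.continuous_ofLp 2 _).comp continuous_snd)

lemma IsUniformOnSphere.smulInvariantMeasure {ρ : Measure (EuclideanSpace ℝ ι)}
    (hρ : IsUniformOnSphere ρ) : SMulInvariantMeasure (Matrix.orthogonalGroup ι ℝ) _ ρ where
  measure_preimage_smul U s hs := by
    have hmap := hρ.map_eq (orthogonalGroupEquivLinearIsometryEquiv U)
    exact (Measure.map_apply (LinearIsometryEquiv.continuous _).measurable hs).symm.trans
      (congrArg (· s) hmap)

/-- The rows of an orthogonal matrix as vectors of Euclidean space. -/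
def orthogonalRow (i : ι) (U : Matrix.orthogonalGroup ι ℝ) : EuclideanSpace ℝ ι :=
  WithLp.toLp 2 (U.1.row i)

lemma orthogonalRow_eq_inv_smul (i : ι) (U : Matrix.orthogonalGroup ι ℝ) :
    orthogonalRow i U = U⁻¹ • EuclideanSpace.single i (1 : ℝ) := by
  ext j
  simp [orthogonalRow, Submonoid.smul_def, Matrix.star_eq_conjTranspose]

lemma norm_orthogonalRow (i : ι) (U : Matrix.orthogonalGroup ι ℝ) : ‖orthogonalRow i U‖ = 1 := by
  rw [orthogonalRow_eq_inv_smul, norm_orthogonalGroup_smul, PiLp.norm_single, norm_one]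

variable {D : ℕ} {Ω : Type*} [MeasurableSpace Ω] {P : Measure Ω} [IsProbabilityMeasure P]
  {Q : Ω → Matrix.orthogonalGroup (Fin D) ℝ}

lemma IsHaarRandom.hasLaw_orthogonalRow (hQ : IsHaarRandom Q P) (i : Fin D)
    {ρ : Measure (EuclideanSpace ℝ (Fin D))} (hρ : IsUniformOnSphere ρ) :
    HasLaw (fun ω => orthogonalRow i (Q ω)) ρ P := by
  obtain ⟨hmeas, hHaar⟩ := hQ
  have := Measure.isProbabilityMeasure_map hmeas
  have := hρ.toIsProbabilityMeasure
  have := hρ.smulInvariantMeasure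
  have horbit : ∀ᵐ x ∂ρ,
      x ∈ MulAction.orbit (Matrix.orthogonalGroup (Fin D) ℝ) (EuclideanSpace.single i (1 : ℝ)) := by
    filter_upwards [hρ.ae_norm_eq_one] with x hx
    rw [mem_orbit_orthogonalGroup_iff, hx, PiLp.norm_single, norm_one]
  simp_rw [orthogonalRow_eq_inv_smul]
  refine ⟨by fun_prop, ?_⟩
  rw [← map_inv_smul_eq_of_ae_mem_orbit (P.map Q) horbit]
  exact (AEMeasurable.map_map_of_aemeasurable
    (g := fun U => U⁻¹ • EuclideanSpace.single i (1 : ℝ)) (by fun_prop) hmeas).symm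

lemma IsHaarRandom.hasLaw_uniformSphere (hQ : IsHaarRandom Q P) (i : Fin D) :
    HasLaw (fun ω => orthogonalRow i (Q ω)) (uniformSphere D) P :=
  hQ.hasLaw_orthogonalRow i (isUniformOnSphere_uniformSphere i.pos)

lemma IsHaarRandom.measureReal_orthogonalRow_mem (hQ : IsHaarRandom Q P) (i : Fin D)
    {s : Set (EuclideanSpace ℝ (Fin D))} (hs : MeasurableSet s) (hcone : IsConical s) :
    P.real {ω | orthogonalRow i (Q ω) ∈ s} = (stdGaussian (EuclideanSpace ℝ (Fin D))).real s := by
  have : Nonempty (Fin D) := ⟨i⟩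
  have hlaw := hQ.hasLaw_orthogonalRow i isUniformOnSphere_map_normalize_stdGaussian
  calc P.real {ω | orthogonalRow i (Q ω) ∈ s}
      = (P.map fun ω => orthogonalRow i (Q ω)).real s :=
        (map_measureReal_apply_of_aemeasurable hlaw.aemeasurable hs).symm
    _ = (stdGaussian _).real (NormedSpace.normalize ⁻¹' s) := by
        rw [hlaw.map_eq, map_measureReal_apply measurable_normalize hs]
    _ = (stdGaussian _).real s := by
        congr 1
        ext x
        exact hcone.normalize_mem_iff x

end OrthogonalGroup

section Angle

lemma setLIntegral_radial_of_isConical {f : ℝ → ENNReal} (hf : Measurable f) {s : Set (ℝ × ℝ)}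
    (hs : MeasurableSet s) (hcone : IsConical s) :
    ∫⁻ p in s, f (p.1 ^ 2 + p.2 ^ 2) =
      (∫⁻ r in Set.Ioi (0 : ℝ), ENNReal.ofReal r * f (r ^ 2)) *
        volume (Set.Ioo (-Real.pi) Real.pi ∩ {φ | (Real.cos φ, Real.sin φ) ∈ s}) := by
  set t : Set ℝ := {φ | (Real.cos φ, Real.sin φ) ∈ s}
  have ht : MeasurableSet t := measurableSet_preimage (by fun_prop) hs
  have hpolar {p : ℝ × ℝ} (hp : p ∈ Set.Ioi (0 : ℝ) ×ˢ Set.Ioo (-Real.pi) Real.pi) :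
      polarCoord.symm p ∈ s ↔ p.2 ∈ t := by
    rw [polarCoord_symm_apply, ← smul_eq_mul, ← smul_eq_mul, ← Prod.smul_mk]
    exact hcone p.1 hp.1 _
  calc ∫⁻ p in s, f (p.1 ^ 2 + p.2 ^ 2)
      = ∫⁻ p in Set.Ioi (0 : ℝ) ×ˢ Set.Ioo (-Real.pi) Real.pi,
          ENNReal.ofReal p.1 * f (p.1 ^ 2) * t.indicator 1 p.2 := by
        rw [← lintegral_indicator hs, ← lintegral_comp_polarCoord_symm, polarCoord_target]
        refine setLIntegral_congr_fun (measurableSet_Ioi.prod measurableSet_Ioo) fun p hp => ?_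
        have hnorm : (p.1 * Real.cos p.2) ^ 2 + (p.1 * Real.sin p.2) ^ 2 = p.1 ^ 2 := by
          linear_combination p.1 ^ 2 * Real.sin_sq_add_cos_sq p.2
        by_cases h : p.2 ∈ t
        · rw [Set.indicator_of_mem ((hpolar hp).2 h), Set.indicator_of_mem h,
            polarCoord_symm_apply, hnorm, Pi.one_apply, mul_one, smul_eq_mul]
        · rw [Set.indicator_of_notMem (mt (hpolar hp).1 h), Set.indicator_of_notMem h, smul_zero,
            mul_zero]
    _ = (∫⁻ r in Set.Ioi (0 : ℝ), ENNReal.ofReal r * f (r ^ 2)) *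
          ∫⁻ φ in Set.Ioo (-Real.pi) Real.pi, t.indicator 1 φ := by
        rw [Measure.volume_eq_prod, ← Measure.prod_restrict]
        exact lintegral_prod_mul (f := fun r => ENNReal.ofReal r * f (r ^ 2)) (by fun_prop)
          (measurable_one.indicator ht).aemeasurable
    _ = _ := by
        rw [lintegral_indicator_one ht, Measure.restrict_apply ht, Set.inter_comm]

lemma gaussianReal_prod_eq_withDensity :
    (gaussianReal 0 1).prod (gaussianReal 0 1) = (volume : Measure (ℝ × ℝ)).withDensity
      fun p => ENNReal.ofReal ((2 * Real.pi)⁻¹ * Real.exp (-(p.1 ^ 2 + p.2 ^ 2) / 2)) := by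
  rw [gaussianReal_of_var_ne_zero _ one_ne_zero, prod_withDensity (by fun_prop) (by fun_prop),
    Measure.volume_eq_prod]
  congr with p
  rw [gaussianPDF, gaussianPDF, ← ENNReal.ofReal_mul (gaussianPDFReal_nonneg _ _ _)]
  simp only [gaussianPDFReal, NNReal.coe_one, mul_one, sub_zero]
  rw [mul_mul_mul_comm, ← Real.exp_add, ← mul_inv, Real.mul_self_sqrt (by positivity)]
  ring_nf

lemma measureReal_gaussianReal_prod_of_isConical {s : Set (ℝ × ℝ)} (hs : MeasurableSet s)
    (hcone : IsConical s) :
    ((gaussianReal 0 1).prod (gaussianReal 0 1)).real s =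
      volume.real (Set.Ioo (-Real.pi) Real.pi ∩ {φ | (Real.cos φ, Real.sin φ) ∈ s}) /
        (2 * Real.pi) := by
  obtain ⟨c, hc⟩ : ∃ c : ℝ, ∀ t : Set (ℝ × ℝ), MeasurableSet t → IsConical t →
      ((gaussianReal 0 1).prod (gaussianReal 0 1)).real t =
        c * volume.real (Set.Ioo (-Real.pi) Real.pi ∩ {φ | (Real.cos φ, Real.sin φ) ∈ t}) := by
    refine ⟨(∫⁻ r in Set.Ioi (0 : ℝ), ENNReal.ofReal r *
      ENNReal.ofReal ((2 * Real.pi)⁻¹ * Real.exp (-r ^ 2 / 2))).toReal, fun t ht htcone => ?_⟩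
    rw [measureReal_def, gaussianReal_prod_eq_withDensity, withDensity_apply _ ht,
      setLIntegral_radial_of_isConical
        (f := fun r => ENNReal.ofReal ((2 * Real.pi)⁻¹ * Real.exp (-r / 2))) (by fun_prop) ht
        htcone,
      ENNReal.toReal_mul]
    rfl
  -- The radial constant is found by taking the whole plane as the conical set.
  have htotal := hc Set.univ MeasurableSet.univ fun _ _ _ => Iff.rfl
  have hpi := Real.pi_pos
  rw [probReal_univ] at htotal
  simp only [Set.mem_univ, Set.ofPred_true, Set.inter_univ] at htotal
  rw [Real.volume_real_Ioo_of_le (by linarith)] at htotal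
  rw [hc s hs hcone, eq_div_iff (by positivity)]
  linear_combination -volume.real
    (Set.Ioo (-Real.pi) Real.pi ∩ {φ | (Real.cos φ, Real.sin φ) ∈ s}) * htotal

lemma cos_sq_lt_sin_sq_iff {α φ : ℝ} (hα : α ∈ Set.Icc 0 (Real.pi / 2)) (hφ : |φ| ≤ Real.pi) :
    Real.cos φ ^ 2 < Real.sin α ^ 2 ↔ |φ| ∈ Set.Ioo (Real.pi / 2 - α) (Real.pi / 2 + α) := by
  obtain ⟨hα0, hα1⟩ := hα
  have hlower := Real.strictAntiOn_cos.lt_iff_gt (a := |φ|) (b := Real.pi / 2 - α)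
    ⟨abs_nonneg φ, hφ⟩ ⟨by linarith, by linarith⟩
  have hupper := Real.strictAntiOn_cos.lt_iff_gt (a := Real.pi / 2 + α) (b := |φ|)
    ⟨by linarith, by linarith⟩ ⟨abs_nonneg φ, hφ⟩
  rw [Real.cos_pi_div_two_sub, Real.cos_abs] at hlower
  rw [Real.cos_abs, add_comm, Real.cos_add_pi_div_two] at hupper
  rw [sq_lt_sq, abs_of_nonneg (Real.sin_nonneg_of_nonneg_of_le_pi hα0 (by linarith)), abs_lt,
    hlower, hupper, Set.mem_Ioo, and_comm, add_comm α]

lemma volume_real_abs_mem_Ioo {a b : ℝ} (ha : 0 ≤ a) (hab : a ≤ b) :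
    volume.real {x : ℝ | |x| ∈ Set.Ioo a b} = 2 * (b - a) := by
  rcases hab.eq_or_lt with rfl | hlt
  · simp
  have hdiff : {x : ℝ | |x| ∈ Set.Ioo a b} = Set.Ioo (-b) b \ Set.Icc (-a) a := by
    ext x
    rw [Set.mem_sdiff, Set.mem_Icc, ← abs_le, Set.mem_Ioo, ← abs_lt, not_le, and_comm]
    rfl
  rw [hdiff, measureReal_sdiff (Set.Icc_subset_Ioo (by linarith) hlt) measurableSet_Icc
      measure_Ioo_lt_top.ne,
    Real.volume_real_Ioo_of_le (by linarith), Real.volume_real_Icc_of_le (by linarith)]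
  ring

lemma measureReal_gaussianReal_prod_cos_mul_sq_lt {α : ℝ} (hα : α ∈ Set.Icc 0 (Real.pi / 2)) :
    ((gaussianReal 0 1).prod (gaussianReal 0 1)).real
      {p | (Real.cos α * p.1) ^ 2 < (Real.sin α * p.2) ^ 2} = 2 * α / Real.pi := by
  have hcone : IsConical {p : ℝ × ℝ | (Real.cos α * p.1) ^ 2 < (Real.sin α * p.2) ^ 2} := by
    intro r hr p
    simp only [Set.mem_ofPred_eq, Prod.smul_fst, Prod.smul_snd, smul_eq_mul, mul_left_comm _ r,
      mul_pow r]
    exact mul_lt_mul_iff_right₀ (pow_pos hr 2)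
  have hangle (φ : ℝ) : (Real.cos α * Real.cos φ) ^ 2 < (Real.sin α * Real.sin φ) ^ 2 ↔
      Real.cos φ ^ 2 < Real.sin α ^ 2 := by
    have hdiff : (Real.cos α * Real.cos φ) ^ 2 - (Real.sin α * Real.sin φ) ^ 2 =
        Real.cos φ ^ 2 - Real.sin α ^ 2 := by
      rw [mul_pow, mul_pow, Real.cos_sq' α, Real.sin_sq φ]
      ring
    rw [← sub_neg, hdiff, sub_neg]
  have harc : Set.Ioo (-Real.pi) Real.pi ∩
      {φ | (Real.cos α * Real.cos φ) ^ 2 < (Real.sin α * Real.sin φ) ^ 2} =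
        {φ | |φ| ∈ Set.Ioo (Real.pi / 2 - α) (Real.pi / 2 + α)} := by
    ext φ
    rw [Set.mem_inter_iff, Set.mem_ofPred_eq, Set.mem_ofPred_eq, Set.mem_Ioo, ← abs_lt, hangle]
    constructor
    · exact fun ⟨hφ, hlt⟩ => (cos_sq_lt_sin_sq_iff hα hφ.le).1 hlt
    · intro hφ
      have hφ_lt : |φ| < Real.pi := hφ.2.trans_le (by linarith [hα.2])
      exact ⟨hφ_lt, (cos_sq_lt_sin_sq_iff hα hφ_lt.le).2 hφ⟩
  rw [measureReal_gaussianReal_prod_of_isConical (measurableSet_lt (by fun_prop) (by fun_prop))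
    hcone]
  simp only [Set.mem_ofPred_eq]
  rw [harc, volume_real_abs_mem_Ioo (by linarith [hα.2]) (by linarith [hα.1])]
  field_simp
  ring

section

variable {E : Type*} [NormedAddCommGroup E] [InnerProductSpace ℝ E]

lemma norm_add_sq_eq_of_norm_eq_one {x y : E} (hx : ‖x‖ = 1) (hy : ‖y‖ = 1) :
    ‖x + y‖ ^ 2 = (2 * Real.cos (InnerProductGeometry.angle x y / 2)) ^ 2 := by
  rw [norm_add_sq_real, ← InnerProductGeometry.cos_angle_mul_norm_mul_norm, mul_pow,
    Real.cos_sq, mul_div_cancel₀ _ two_ne_zero, hx, hy]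
  ring

lemma norm_sub_sq_eq_of_norm_eq_one {x y : E} (hx : ‖x‖ = 1) (hy : ‖y‖ = 1) :
    ‖x - y‖ ^ 2 = (2 * Real.sin (InnerProductGeometry.angle x y / 2)) ^ 2 := by
  rw [norm_sub_sq_real, ← InnerProductGeometry.cos_angle_mul_norm_mul_norm, mul_pow, Real.sin_sq,
    Real.cos_sq, mul_div_cancel₀ _ two_ne_zero, hx, hy]
  ring

lemma isConical_sign_inner_eq_sign_inner (x y : E) :
    IsConical {g : E | SignType.sign ⟪x, g⟫ = SignType.sign ⟪y, g⟫} := by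
  intro r hr g
  simp only [Set.mem_ofPred_eq, real_inner_smul_right, sign_mul, sign_pos hr, one_mul]

variable [FiniteDimensional ℝ E] [MeasurableSpace E] [BorelSpace E]

lemma map_inner_prod_stdGaussian_of_inner_eq_zero {a b : E} (hab : ⟪a, b⟫ = 0) :
    (stdGaussian E).map (fun g => (⟪a, g⟫, ⟪b, g⟫)) =
      ((gaussianReal 0 1).prod (gaussianReal 0 1)).map (Prod.map (‖a‖ * ·) (‖b‖ * ·)) := by
  have hgauss : HasGaussianLaw (fun g => (⟪a, g⟫, ⟪b, g⟫)) (stdGaussian E) :=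
    IsGaussian.hasGaussianLaw_id.map ((innerSL ℝ a).prod (innerSL ℝ b))
  have hcov : cov[fun g => ⟪a, g⟫, fun g => ⟪b, g⟫; stdGaussian E] = 0 := by
    rw [← covarianceBilin_apply_eq_cov IsGaussian.memLp_two_id, covarianceBilin_stdGaussian]
    exact hab
  have hlaw (v : E) : (stdGaussian E).map (fun g => ⟪v, g⟫) = (gaussianReal 0 1).map (‖v‖ * ·) := by
    rw [map_inner_stdGaussian, gaussianReal_map_const_mul, mul_zero, mul_one]
    rfl
  rw [(indepFun_iff_map_prod_eq_prod_map_map (by fun_prop) (by fun_prop)).1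
    (hgauss.indepFun_of_covariance_eq_zero hcov), hlaw, hlaw,
    Measure.map_prod_map _ _ (by fun_prop) (by fun_prop)]

lemma measureReal_stdGaussian_inner_mul_inner_neg_of_norm_eq_one {x y : E} (hx : ‖x‖ = 1)
    (hy : ‖y‖ = 1) :
    (stdGaussian E).real {g | ⟪x, g⟫ * ⟪y, g⟫ < 0} =
      InnerProductGeometry.angle x y / Real.pi := by
  have horth : ⟪x + y, x - y⟫ = 0 :=
    (real_inner_add_sub_eq_zero_iff x y).2 (hx.trans hy.symm)
  have hpolarize (g : E) : ⟪x, g⟫ * ⟪y, g⟫ < 0 ↔ ⟪x + y, g⟫ ^ 2 < ⟪x - y, g⟫ ^ 2 := by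
    rw [inner_add_left, inner_sub_left]
    constructor <;> intro h <;> linarith
  have hα : InnerProductGeometry.angle x y / 2 ∈ Set.Icc 0 (Real.pi / 2) :=
    ⟨by linarith [InnerProductGeometry.angle_nonneg x y],
      by linarith [InnerProductGeometry.angle_le_pi x y]⟩
  have hmeas : MeasurableSet {p : ℝ × ℝ | p.1 ^ 2 < p.2 ^ 2} :=
    measurableSet_lt (by fun_prop) (by fun_prop)
  calc (stdGaussian E).real {g | ⟪x, g⟫ * ⟪y, g⟫ < 0}
      = ((stdGaussian E).map fun g => (⟪x + y, g⟫, ⟪x - y, g⟫)).real {p | p.1 ^ 2 < p.2 ^ 2} := by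
        rw [map_measureReal_apply (by fun_prop) hmeas]
        simp only [hpolarize, Set.preimage_ofPred_eq]
    _ = ((gaussianReal 0 1).prod (gaussianReal 0 1)).real
          {p | (‖x + y‖ * p.1) ^ 2 < (‖x - y‖ * p.2) ^ 2} := by
        rw [map_inner_prod_stdGaussian_of_inner_eq_zero horth,
          map_measureReal_apply (by fun_prop) hmeas]
        rfl
    _ = ((gaussianReal 0 1).prod (gaussianReal 0 1)).real
          {p | (Real.cos (InnerProductGeometry.angle x y / 2) * p.1) ^ 2 <
            (Real.sin (InnerProductGeometry.angle x y / 2) * p.2) ^ 2} := by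
        simp only [mul_pow, norm_add_sq_eq_of_norm_eq_one hx hy,
          norm_sub_sq_eq_of_norm_eq_one hx hy, mul_assoc]
        congr! 3
        norm_num
    _ = InnerProductGeometry.angle x y / Real.pi := by
        rw [measureReal_gaussianReal_prod_cos_mul_sq_lt hα, mul_div_cancel₀ _ two_ne_zero]

lemma measureReal_stdGaussian_inner_mul_inner_neg {x y : E} (hx : x ≠ 0) (hy : y ≠ 0) :
    (stdGaussian E).real {g | ⟪x, g⟫ * ⟪y, g⟫ < 0} =
      InnerProductGeometry.angle x y / Real.pi := by
  have hnormalize (g : E) : ⟪x, g⟫ * ⟪y, g⟫ < 0 ↔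
      ⟪NormedSpace.normalize x, g⟫ * ⟪NormedSpace.normalize y, g⟫ < 0 := by
    have hpos : 0 < ‖x‖ * ‖y‖ := mul_pos (norm_pos_iff.2 hx) (norm_pos_iff.2 hy)
    conv_lhs => rw [← NormedSpace.norm_smul_normalize x, ← NormedSpace.norm_smul_normalize y,
      real_inner_smul_left, real_inner_smul_left, mul_mul_mul_comm]
    exact smul_neg_iff_of_pos_left hpos
  simp only [hnormalize]
  rw [measureReal_stdGaussian_inner_mul_inner_neg_of_norm_eq_one
    (NormedSpace.norm_normalize hx) (NormedSpace.norm_normalize hy),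
    InnerProductGeometry.angle_normalize_left, InnerProductGeometry.angle_normalize_right]

lemma measurableSet_sign_eq_sign {α : Type*} [MeasurableSpace α] {f g : α → ℝ}
    (hf : Measurable f) (hg : Measurable g) :
    MeasurableSet {a | SignType.sign (f a) = SignType.sign (g a)} := by
  let : MeasurableSpace SignType := ⊤
  have hsign : Measurable (SignType.sign : ℝ → SignType) :=
    .ite measurableSet_Ioi measurable_const
      (.ite measurableSet_Iio measurable_const measurable_const)
  exact measurableSet_eq_fun (hsign.comp hf) (hsign.comp hg)

lemma sign_eq_sign_iff_not_mul_neg {a b : ℝ} (ha : a ≠ 0) (hb : b ≠ 0) :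
    SignType.sign a = SignType.sign b ↔ ¬ a * b < 0 := by
  rcases ha.lt_or_gt with ha | ha <;> rcases hb.lt_or_gt with hb | hb <;>
    simp [ha, hb, mul_neg_iff, ha.not_gt, hb.not_gt]

lemma measureReal_stdGaussian_sign_inner_eq_sign_inner {x y : E} (hx : x ≠ 0) (hy : y ≠ 0) :
    (stdGaussian E).real {g | SignType.sign ⟪x, g⟫ = SignType.sign ⟪y, g⟫} =
      1 - InnerProductGeometry.angle x y / Real.pi := by
  have hae : ({g | SignType.sign ⟪x, g⟫ = SignType.sign ⟪y, g⟫} : Set E) =ᵐ[stdGaussian E]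
      ({g | ⟪x, g⟫ * ⟪y, g⟫ < 0}ᶜ : Set E) := by
    filter_upwards [ae_inner_ne_zero_stdGaussian hx, ae_inner_ne_zero_stdGaussian hy] with g hxg hyg
    exact propext (sign_eq_sign_iff_not_mul_neg hxg hyg)
  rw [measureReal_congr hae, probReal_compl_eq_one_sub
    (measurableSet_lt (by fun_prop) measurable_const),
    measureReal_stdGaussian_inner_mul_inner_neg hx hy]

end

end Angle

section UnionBound

lemma one_sub_sum_le_measureReal_iSup_le {Ω ι : Type*} [MeasurableSpace Ω] (P : Measure Ω)
    [IsProbabilityMeasure P] [Fintype ι] [Nonempty ι] (f : ι → Ω → ℝ) (t : ℝ) :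
    1 - ∑ i, P.real {ω | t < f i ω} ≤ P.real {ω | ⨆ i, f i ω ≤ t} := by
  have hcover : (Set.univ : Set Ω) ⊆ {ω | ⨆ i, f i ω ≤ t} ∪ ⋃ i, {ω | t < f i ω} := by
    intro ω _
    by_cases h : ∃ i, t < f i ω
    · exact Or.inr (Set.mem_iUnion.2 h)
    · exact Or.inl (ciSup_le fun i => not_lt.1 (not_exists.1 h i))
  have htotal := (measureReal_mono (μ := P) hcover).trans (measureReal_union_le _ _)
  have hunion := measureReal_iUnion_fintype_le (μ := P) fun i => {ω | t < f i ω}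
  rw [probReal_univ] at htotal
  linarith

lemma mul_two_mul_exp_neg_mul_log_le_rpow {x : ℝ} (hx : 2 ≤ x) (c : ℝ) :
    x * (2 * Real.exp (-((c + 2) * Real.log x))) ≤ x ^ (-c) := by
  have hx0 : 0 < x := by linarith
  calc x * (2 * Real.exp (-((c + 2) * Real.log x))) = 2 * x * x ^ (-(c + 2)) := by
        rw [Real.rpow_def_of_pos hx0]
        ring_nf
    _ ≤ x ^ 2 * x ^ (-(c + 2)) := by
        gcongr
        nlinarith
    _ = x ^ (-c) := by
        rw [← Real.rpow_natCast, ← Real.rpow_add hx0]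
        congr 1
        push_cast
        ring

end UnionBound

lemma isConical_lt_abs_inner_map_self_sub {E : Type*} [NormedAddCommGroup E]
    [InnerProductSpace ℝ E] (T : E →L[ℝ] E) (a m : ℝ) :
    IsConical {g | a * ‖g‖ ^ 2 < |⟪T g, g⟫ - m * ‖g‖ ^ 2|} := by
  intro r hr g
  have hdev : ⟪T (r • g), r • g⟫ - m * ‖r • g‖ ^ 2 =
      r ^ 2 * (⟪T g, g⟫ - m * ‖g‖ ^ 2) := by
    rw [map_smul, real_inner_smul_left, real_inner_smul_right, norm_smul, mul_pow,
      Real.norm_eq_abs, sq_abs]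
    ring
  rw [Set.mem_ofPred_eq, hdev, abs_mul, abs_of_pos (pow_pos hr 2), norm_smul, mul_pow,
    Real.norm_eq_abs, sq_abs, mul_left_comm]
  exact mul_lt_mul_iff_right₀ (pow_pos hr 2)

section HaarRandom

variable {D : ℕ} {Ω : Type*} [MeasurableSpace Ω] {P : Measure Ω} [IsProbabilityMeasure P]
  {Q : Ω → Matrix.orthogonalGroup (Fin D) ℝ}

lemma signHash_eq_sign_inner (U : Matrix.orthogonalGroup (Fin D) ℝ)
    (x : EuclideanSpace ℝ (Fin D)) (i : Fin D) :
    signHash U.1 x i = SignType.sign ⟪orthogonalRow i U, x⟫ := by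
  rw [signHash, EuclideanSpace.inner_eq_star_dotProduct, dotProduct_comm]
  rfl

lemma IsHaarRandom.isRandomHyperplaneHash (hQ : IsHaarRandom Q P) (i : Fin D) :
    IsRandomHyperplaneHash (fun ω x => signHash (Q ω).1 x i) P :=
  ⟨fun ω => orthogonalRow i (Q ω), hQ.hasLaw_uniformSphere i,
    fun ω x => signHash_eq_sign_inner (Q ω) x i⟩

lemma IsHaarRandom.measureReal_signHash_eq (hQ : IsHaarRandom Q P) (i : Fin D)
    {x y : EuclideanSpace ℝ (Fin D)} (hx : x ≠ 0) (hy : y ≠ 0) :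
    P.real {ω | signHash (Q ω).1 x i = signHash (Q ω).1 y i} =
      1 - Real.arccos (cosSim x y) / Real.pi := by
  simp only [signHash_eq_sign_inner, real_inner_comm _ (orthogonalRow i _)]
  exact (hQ.measureReal_orthogonalRow_mem i
    (measurableSet_sign_eq_sign (by fun_prop) (by fun_prop))
    (isConical_sign_inner_eq_sign_inner x y)).trans
      (measureReal_stdGaussian_sign_inner_eq_sign_inner hx hy)

lemma trace_toEuclideanCLM (S : Matrix (Fin D) (Fin D) ℝ) :
    LinearMap.trace ℝ (EuclideanSpace ℝ (Fin D)) (Matrix.toEuclideanCLM (𝕜 := ℝ) S) = S.trace :=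
  Matrix.trace_toLin_eq S (EuclideanSpace.basisFun (Fin D) ℝ).toBasis

lemma rotatedVariance_eq_inner (U : Matrix.orthogonalGroup (Fin D) ℝ)
    (S : Matrix (Fin D) (Fin D) ℝ) (i : Fin D) :
    rotatedVariance U.1 S i =
      ⟪Matrix.toEuclideanCLM (𝕜 := ℝ) S (orthogonalRow i U), orthogonalRow i U⟫ := by
  rw [real_inner_comm, Matrix.inner_toEuclideanCLM]
  rfl

lemma IsHaarRandom.measureReal_lt_abs_rotatedVariance_sub_le (hQ : IsHaarRandom Q P) (i : Fin D)
    (S : Matrix (Fin D) (Fin D) ℝ) {ε : ℝ} (hε : 0 ≤ ε) :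
    P.real {ω | ε * opNorm S < |rotatedVariance (Q ω).1 S i - S.trace / D|} ≤
      2 * Real.exp (-(D * ε ^ 2 / 128)) := by
  set T := Matrix.toEuclideanCLM (𝕜 := ℝ) S
  set s : Set (EuclideanSpace ℝ (Fin D)) :=
    {g | ε * ‖T‖ * ‖g‖ ^ 2 < |⟪T g, g⟫ - S.trace / D * ‖g‖ ^ 2|}
  have hs : MeasurableSet s := measurableSet_lt (by fun_prop) (by fun_prop)
  have hcone : IsConical s := isConical_lt_abs_inner_map_self_sub T _ _
  have hrow : {ω | ε * opNorm S < |rotatedVariance (Q ω).1 S i - S.trace / D|} =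
      {ω | orthogonalRow i (Q ω) ∈ s} := by
    ext ω
    simp only [s, Set.mem_ofPred_eq, rotatedVariance_eq_inner, norm_orthogonalRow, one_pow, mul_one]
    rfl
  rw [hrow, hQ.measureReal_orthogonalRow_mem i hs hcone]
  have htrace : LinearMap.trace ℝ (EuclideanSpace ℝ (Fin D)) T = S.trace := trace_toEuclideanCLM S
  simpa only [htrace, finrank_euclideanSpace_fin] using
    measureReal_stdGaussian_lt_abs_inner_map_self_sub_le T hε

lemma IsHaarRandom.one_sub_rpow_neg_le_measureReal_iSup_rotatedVariance (hQ : IsHaarRandom Q P)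
    (hD : 2 ≤ D) (S : Matrix (Fin D) (Fin D) ℝ) {c : ℝ} (hc : 0 ≤ c + 2) :
    1 - (D : ℝ) ^ (-c) ≤
      P.real {ω | (⨆ i : Fin D, |rotatedVariance (Q ω).1 S i - S.trace / D|) ≤
        8 * √(2 * (c + 2)) * opNorm S * √(Real.log D / D)} := by
  have : Nonempty (Fin D) := ⟨⟨0, by lia⟩⟩
  have hD_real : (2 : ℝ) ≤ D := mod_cast hD
  set ε := 8 * √(2 * (c + 2)) * √(Real.log D / D)
  have hexponent : D * ε ^ 2 / 128 = (c + 2) * Real.log D := by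
    simp only [ε]
    rw [mul_pow, mul_pow, Real.sq_sqrt (by positivity), Real.sq_sqrt (by positivity)]
    field_simp
    ring
  have htail (i : Fin D) :
      P.real {ω | ε * opNorm S < |rotatedVariance (Q ω).1 S i - S.trace / D|} ≤
        2 * Real.exp (-((c + 2) * Real.log D)) :=
    hexponent ▸ hQ.measureReal_lt_abs_rotatedVariance_sub_le i S (by positivity)
  have hsum : ∑ i, P.real {ω | ε * opNorm S < |rotatedVariance (Q ω).1 S i - S.trace / D|} ≤
      (D : ℝ) ^ (-c) := by
    refine (Finset.sum_le_sum fun i _ => htail i).trans ?_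
    rw [Finset.sum_const, Finset.card_univ, Fintype.card_fin, nsmul_eq_mul]
    exact mul_two_mul_exp_neg_mul_log_le_rpow hD_real c
  rw [mul_right_comm]
  exact (sub_le_sub_left hsum 1).trans (one_sub_sum_le_measureReal_iSup_le P _ _)

end HaarRandom

theorem mainTheorem3_general :
    (∀ (D : ℕ) (Ω : Type*) [MeasurableSpace Ω] (P : Measure Ω) [IsProbabilityMeasure P]
      (Q : Ω → Matrix.orthogonalGroup (Fin D) ℝ), IsHaarRandom Q P → ∀ i : Fin D,
        IsRandomHyperplaneHash (fun ω x => signHash (Q ω).1 x i) P ∧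
        ∀ x y : EuclideanSpace ℝ (Fin D), x ≠ 0 → y ≠ 0 →
          P.real {ω | signHash (Q ω).1 x i = signHash (Q ω).1 y i} =
            1 - Real.arccos (cosSim x y) / Real.pi) ∧
    (∀ c : ℝ, 0 < c → ∃ C : ℝ, 0 < C ∧
      ∀ (D : ℕ), 1 ≤ D → ∀ (Ω : Type*) [MeasurableSpace Ω] (P : Measure Ω) [IsProbabilityMeasure P]
        (Q : Ω → Matrix.orthogonalGroup (Fin D) ℝ), IsHaarRandom Q P →
        ∀ S : Matrix (Fin D) (Fin D) ℝ,
          1 - (D : ℝ) ^ (-c) ≤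
            P.real {ω | (⨆ i : Fin D, |rotatedVariance (Q ω).1 S i - S.trace / D|) ≤
              C * opNorm S * Real.sqrt (Real.log D / D)}) := by
  constructor
  · intro D Ω _ P _ Q hQ i
    exact ⟨hQ.isRandomHyperplaneHash i, fun x y hx hy => hQ.measureReal_signHash_eq i hx hy⟩
  · intro c hc
    refine ⟨8 * √(2 * (c + 2)), by positivity, ?_⟩
    intro D hD Ω _ P _ Q hQ S
    rcases hD.eq_or_lt with rfl | hD
    · simp
    · exact hQ.one_sub_rpow_neg_le_measureReal_iSup_rotatedVariance hD S (by linarith)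

theorem mainTheorem3 :
    (∀ (D : ℕ) (Ω : Type*) [MeasurableSpace Ω] (P : Measure Ω) [IsProbabilityMeasure P]
      (Q : Ω → Matrix.orthogonalGroup (Fin D) ℝ), IsHaarRandom Q P → ∀ i : Fin D,
        IsRandomHyperplaneHash (fun ω x => signHash (Q ω).1 x i) P ∧
        ∀ x y : EuclideanSpace ℝ (Fin D), x ≠ 0 → y ≠ 0 →
          P.real {ω | signHash (Q ω).1 x i = signHash (Q ω).1 y i} =
            1 - Real.arccos (cosSim x y) / Real.pi) ∧
    (∀ c : ℝ, 0 < c → ∃ C : ℝ, 0 < C ∧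
      ∀ (D : ℕ), 1 ≤ D → ∀ (Ω : Type*) [MeasurableSpace Ω] (P : Measure Ω) [IsProbabilityMeasure P]
        (Q : Ω → Matrix.orthogonalGroup (Fin D) ℝ), IsHaarRandom Q P →
        ∀ S : Matrix (Fin D) (Fin D) ℝ, S.PosSemidef →
          1 - (D : ℝ) ^ (-c) ≤
            P.real {ω | (⨆ i : Fin D, |rotatedVariance (Q ω).1 S i - S.trace / D|) ≤
              C * opNorm S * Real.sqrt (Real.log D / D)}) := by
  refine mainTheorem3_general.imp_right fun hvariance c hc => (hvariance c hc).imp fun C hC => ?_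
  exact ⟨hC.1, fun D hD Ω _ P _ Q hQ S _ => hC.2 D hD Ω P Q hQ S⟩
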